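/- Let $f$ be a real- or complex-valued function of a real variable that is real-analytic at $0$. Put $p_f(t)=\frac{e^t-1}{t}f(t)$ (with $p_f(0)=f(0)$), and let $P_{f,n}$ be the numbers defined by the Maclaurin expansion $p_f(t)=\sum_{n\ge 0}\frac{P_{f,n}}{n!}t^n$ near $0$. Assume that the radius of convergence $\rho_f\in[0,+\infty]$ of $\sum_{n\ge 0}P_{f,n}s^n$ is non-zero; then $p_f(s):=\sum_{n\ge 0}\frac{P_{f,n}}{n!}s^n$ is defined for all $s\in\mathbb{C}$. Put $n_f=\lfloor 1/\rho_f\rfloor+1$ (with $1/\infty=0$), and $$s^{(z,f)}=\sum_{k=0}^{\infty}\binom{z}{k}P_{f,k}\,s^{z-k},\qquad L(z,f)=\sum_{n=n_f}^{\infty}n^{(-z,f)} ,$$ with principal powers. Let $0<\varepsilon<2\pi$, and let $\mu$ be the Hankel contour that consists of the lower edge of the cut $(-\infty,0]$ ($s=te^{-i\pi}$, $t$ from $+\infty$ to $\varepsilon$), the circle $s=\varepsilon e^{i\theta}$ ($\theta$ from $-\pi$ to $\pi$), and the upper edge of the cut ($s=te^{i\pi}$, $t$ from $\varepsilon$ to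 $+\infty$). Put $$I(z,f)=\frac{1}{2i\pi}\int_{\mu}\frac{s^{z-1}e^{n_f s}p_f(s)}{1-e^{s}}\,ds ,$$ where $s^{z-1}=r^{z-1}e^{i\theta(z-1)}$ at the point $s=re^{i\theta}$ of $\mu$, $-\pi\le\theta\le\pi$. **Theorem 5.3.** The integral $I(z,f)$ converges absolutely for every $z\in\mathbb{C}$ and is an entire function of $z$. For $\operatorname{Re} z>1$ the series $n^{(-z,f)}$ ($n\ge n_f$) and $L(z,f)$ converge absolutely, and if moreover $z\neq 2,3,4,\dots$, then $$L(z,f)=\Gamma(1-z)\,I(z,f).$$ -/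

import Mathlib

noncomputable section

namespace LCFunction

open scoped ENNReal Real

/-- The function `p_f(t) = ((e^t - 1) / t) f(t)` of a real variable, continued to `t = 0`
by the value of the limit, `p_f(0) = f(0)`. -/
def pReal (f : ℝ → ℂ) (t : ℝ) : ℂ :=
  if t = 0 then f 0 else ((Real.exp t - 1) / t : ℝ) * f t

/-- The P-numbers `P_{f,n}`: the coefficients in the Maclaurin expansion
`p_f(t) = ∑ P_{f,n} t^n / n!`. -/
def pNum (f : ℝ → ℂ) (n : ℕ) : ℂ := iteratedDeriv n (pReal f) 0

/-- `p_f` as a function of a complex variable: the sum of its Maclaurin series. -/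
def pFun (f : ℝ → ℂ) (s : ℂ) : ℂ := ∑' n : ℕ, pNum f n / (n.factorial : ℂ) * s ^ n

/-- `ρ_f`: the radius of convergence (possibly infinite) of the series `∑ P_{f,n} s^n`. -/
def rho (f : ℝ → ℂ) : ℝ≥0∞ := (FormalMultilinearSeries.ofScalars ℂ (pNum f)).radius

/-- `n_f = ⌊1 / ρ_f⌋ + 1`, with `1 / ∞ = 0`. -/
def nIdx (f : ℝ → ℂ) : ℕ := ⌊((rho f)⁻¹).toReal⌋₊ + 1

/-- The `k`-th term `binom(z, k) P_{f,k} s^{z-k}` of the series defining `s^{(z,f)}`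
(principal power). -/
def genPowTerm (f : ℝ → ℂ) (s z : ℂ) (k : ℕ) : ℂ :=
  Ring.choose z k * pNum f k * s ^ (z - (k : ℂ))

/-- `s^{(z,f)} = ∑_{k ≥ 0} binom(z, k) P_{f,k} s^{z-k}`. -/
def genPow (f : ℝ → ℂ) (s z : ℂ) : ℂ := ∑' k : ℕ, genPowTerm f s z k

/-- The LC-function `L(z, f) = ∑_{n ≥ n_f} n^{(-z,f)}`. -/
def LC (f : ℝ → ℂ) (z : ℂ) : ℂ := ∑' n : ℕ, genPow f ((n + nIdx f : ℕ) : ℂ) (-z)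

/-- The integrand `s^{z-1} e^{n_f s} p_f(s) / (1 - e^s)` at `s = r e^{iθ}`, where the branch of
the power is the one with `arg s = θ`, i.e. `s^{z-1} = r^{z-1} e^{iθ(z-1)}`. -/
def integrand (f : ℝ → ℂ) (z : ℂ) (r θ : ℝ) : ℂ :=
  let s : ℂ := r * Complex.exp (θ * Complex.I)
  ((r : ℂ) ^ (z - 1) * Complex.exp (θ * Complex.I * (z - 1)))
    * Complex.exp (nIdx f * s) * pFun f s / (1 - Complex.exp s)

/-- Integrand times `ds/dt` along the ray `s = t e^{iθ}`. -/
def rayIntegrand (f : ℝ → ℂ) (z : ℂ) (θ t : ℝ) : ℂ :=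
  integrand f z t θ * Complex.exp (θ * Complex.I)

/-- Integrand times `ds/dθ` along the circle `s = ε e^{iθ}`. -/
def circleIntegrand (f : ℝ → ℂ) (z : ℂ) (ε θ : ℝ) : ℂ :=
  integrand f z ε θ * (Complex.I * ε * Complex.exp (θ * Complex.I))

/-- `I(z, f) = (1 / 2πi) ∫_μ s^{z-1} e^{n_f s} p_f(s) / (1 - e^s) ds` over the Hankel contour `μ`
of radius `ε`, which consists of
* the lower edge of the cut, `s = t e^{-iπ}`, with `t` running from `+∞` to `ε`;
* the circle `s = ε e^{iθ}`, with `θ` running from `-π` to `π`;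
* the upper edge of the cut, `s = t e^{iπ}`, with `t` running from `ε` to `+∞`. -/
def hankelI (f : ℝ → ℂ) (ε : ℝ) (z : ℂ) : ℂ :=
  1 / (2 * π * Complex.I) *
    (-(∫ t in Set.Ioi ε, rayIntegrand f z (-π) t)
      + (∫ θ in (-π)..π, circleIntegrand f z ε θ)
      + ∫ t in Set.Ioi ε, rayIntegrand f z π t)

end LCFunction

end

/-! Everything rests on `exists_norm_pNum_le`: the P-numbers are `O(R^k)` for some `R < n_f`, so
`p_f` is entire with `p_f(s) = O(e^{R|s|})`, and `e^{-nt} p_f(-t)` decays exponentially for every `n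
≥ n_f`.

Expanding `p_f` under the integral turns each term into a Gamma integral, so `Γ(z) n^{(-z,f)}` is
the Mellin transform of `e^{-nt} p_f(-t)` (`Gamma_mul_genPow`). Summing the geometric series in `n`
gives `Γ(z) L(z,f)` as the Mellin transform of the Hankel kernel at `-t` (`Gamma_mul_LC`).

For `Re z > 1` the contour integral is `sin(πz)/π` times the same transform (`hankelI_eq_mellin`).
The two edges carry phases `e^{±iπz}` and give the part over `(ε, ∞)`; the circle gives exactly the
part over `(0, ε]`. The latter is checked on Taylor coefficients (`integral_exp_mul_circle_eq`),
with no contour deformation and no limit `ε → 0`. The reflection formula concludes. -/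

namespace LCFunction

open scoped ENNReal NNReal Real Topology
open Filter MeasureTheory Set

/-! ### Growth of the P-numbers and of `p_f`. -/

section PNumbers

variable {f : ℝ → ℂ} {C R : ℝ}

/-- Since `⌊x⌋ + 1 > x`, there is room for `R` strictly between `1/ρ_f` and `n_f`; then `1/R` lies
inside the disc of convergence. The strict gap `n_f - R` is the decay rate used throughout. -/
lemma exists_norm_pNum_le (hρ : rho f ≠ 0) :
    ∃ C R : ℝ, 0 < C ∧ 0 < R ∧ R < nIdx f ∧ ∀ k, ‖pNum f k‖ ≤ C * R ^ k := by
  have hx : ((rho f)⁻¹).toReal < nIdx f := by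
    rw [nIdx]; push_cast; exact Nat.lt_floor_add_one _
  have hx0 : 0 ≤ ((rho f)⁻¹).toReal := ENNReal.toReal_nonneg
  obtain ⟨R, hxR, hRn⟩ := exists_between hx
  have hR : 0 < R := hx0.trans_lt hxR
  have hlt : (rho f)⁻¹ < ENNReal.ofReal R := by
    rw [← ENNReal.ofReal_toReal (ENNReal.inv_ne_top.2 hρ)]
    exact (ENNReal.ofReal_lt_ofReal_iff hR).2 hxR
  have hlt' : ((Real.toNNReal R)⁻¹ : ℝ≥0) < rho f := by
    rw [ENNReal.coe_inv (by simpa using hR), ENNReal.inv_lt_iff_inv_lt]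
    exact hlt
  obtain ⟨C, hC, h⟩ := FormalMultilinearSeries.norm_mul_pow_le_of_lt_radius _ hlt'
  refine ⟨C, R, hC, hR, hRn, fun k => ?_⟩
  have := h k
  rw [FormalMultilinearSeries.ofScalars_norm, NNReal.coe_inv, Real.coe_toNNReal _ hR.le, inv_pow,
    ← div_eq_mul_inv, div_le_iff₀ (by positivity)] at this
  exact this

lemma norm_pNum_div_factorial_mul_pow_le (h : ∀ k, ‖pNum f k‖ ≤ C * R ^ k) (s : ℂ) (k : ℕ) :
    ‖pNum f k / (k.factorial : ℂ) * s ^ k‖ ≤ C * ((R * ‖s‖) ^ k / k.factorial) := by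
  rw [norm_mul, norm_div, norm_pow, Complex.norm_natCast, mul_pow]
  calc ‖pNum f k‖ / k.factorial * ‖s‖ ^ k ≤ C * R ^ k / k.factorial * ‖s‖ ^ k := by
        gcongr; exact h k
    _ = _ := by ring

lemma hasSum_mul_pow_div_factorial (C x : ℝ) :
    HasSum (fun k : ℕ => C * (x ^ k / k.factorial)) (C * Real.exp x) := by
  have := (NormedSpace.expSeries_div_hasSum_exp x).mul_left C
  rwa [← Real.exp_eq_exp_ℝ] at this

lemma hasSum_pFun (h : ∀ k, ‖pNum f k‖ ≤ C * R ^ k) (s : ℂ) :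
    HasSum (fun k : ℕ => pNum f k / (k.factorial : ℂ) * s ^ k) (pFun f s) :=
  (Summable.of_norm_bounded (hasSum_mul_pow_div_factorial C (R * ‖s‖)).summable
    (norm_pNum_div_factorial_mul_pow_le h s)).hasSum

lemma norm_pFun_le (h : ∀ k, ‖pNum f k‖ ≤ C * R ^ k) (s : ℂ) :
    ‖pFun f s‖ ≤ C * Real.exp (R * ‖s‖) :=
  tsum_of_norm_bounded (hasSum_mul_pow_div_factorial C (R * ‖s‖))
    (norm_pNum_div_factorial_mul_pow_le h s)

lemma differentiable_pFun (hC : 0 ≤ C) (hR : 0 ≤ R) (h : ∀ k, ‖pNum f k‖ ≤ C * R ^ k) :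
    Differentiable ℂ (pFun f) := by
  intro s
  have : DifferentiableOn ℂ (pFun f) (Metric.ball 0 (‖s‖ + 1)) := by
    refine Complex.differentiableOn_tsum_of_summable_norm
      (hasSum_mul_pow_div_factorial C (R * (‖s‖ + 1))).summable (fun k => by fun_prop)
      Metric.isOpen_ball fun k w hw => ?_
    refine (norm_pNum_div_factorial_mul_pow_le h w k).trans ?_
    have : ‖w‖ ≤ ‖s‖ + 1 := (mem_ball_zero_iff.1 hw).le
    gcongr
  exact this.differentiableAt (Metric.isOpen_ball.mem_nhds (by simp))

end PNumbers

/-- `binom(-z, k) k! Γ(z) = (-1)^k Γ(z + k)`. -/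
lemma choose_neg_mul_Gamma {z : ℂ} (hz : 0 < z.re) (k : ℕ) :
    Ring.choose (-z) k * Complex.Gamma z
      = (-1) ^ k / (k.factorial : ℂ) * Complex.Gamma (z + k) := by
  -- The falling factorial version follows by induction from `Γ(w + 1) = w Γ(w)`; division by `k!`
  -- comes last.
  have key : (descPochhammer ℤ k).smeval (-z) * Complex.Gamma z
      = (-1) ^ k * Complex.Gamma (z + k) := by
    induction k with
    | zero => simp
    | succ k ih =>
      have hne : z + k ≠ 0 := fun h => by
        have := congrArg Complex.re h
        simp at this
        have : (0 : ℝ) ≤ k := k.cast_nonneg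
        linarith
      rw [descPochhammer_succ_right, Polynomial.smeval_mul]
      have h1 : (Polynomial.X - (k : Polynomial ℤ)).smeval (-z) = -z - k := by
        simp [Polynomial.smeval_sub, Polynomial.smeval_X, Polynomial.smeval_natCast]
      rw [h1, mul_right_comm, ih, Nat.cast_succ, ← add_assoc, Complex.Gamma_add_one _ hne]
      ring
  rw [Ring.descPochhammer_eq_factorial_smul_choose, nsmul_eq_mul, mul_assoc] at key
  have : (k.factorial : ℂ) ≠ 0 := Nat.cast_ne_zero.2 k.factorial_ne_zero
  rw [div_mul_eq_mul_div, eq_div_iff this, ← key]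
  ring

lemma integrableOn_rpow_mul_exp_neg {σ r : ℝ} (hσ : 0 < σ) (hr : 0 < r) :
    IntegrableOn (fun t : ℝ => t ^ (σ - 1) * Real.exp (-(r * t))) (Ioi 0) := by
  -- A non-integrable function has integral `0` by convention, whereas this integral is a positive
  -- Gamma value.
  refine not_imp_comm.1 integral_undef ?_
  rw [Real.integral_rpow_mul_exp_neg_mul_Ioi hσ hr]
  have := Real.Gamma_pos_of_pos hσ
  positivity

lemma continuousOn_cpow_sub_one (z : ℂ) :
    ContinuousOn (fun t : ℝ => (t : ℂ) ^ (z - 1)) (Ioi 0) := fun t ht =>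
  (Complex.continuousAt_ofReal_cpow_const t (z - 1) (Or.inr (ne_of_gt ht))).continuousWithinAt

/-! ### Generalized powers as Mellin transforms. -/

section Laplace

variable {f : ℝ → ℂ} {C R : ℝ} {z : ℂ} {n : ℕ}

lemma norm_cpow_mul_exp_mul_pFun_le (h : ∀ k, ‖pNum f k‖ ≤ C * R ^ k) (z : ℂ) (n : ℕ)
    {t : ℝ} (ht : 0 < t) :
    ‖(t : ℂ) ^ (z - 1) * (Complex.exp (n * (-t : ℂ)) * pFun f (-t))‖
      ≤ C * (t ^ (z.re - 1) * Real.exp (-((n - R) * t))) := by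
  have h1 := norm_pFun_le h (-(t : ℂ))
  rw [norm_neg, Complex.norm_real, Real.norm_of_nonneg ht.le] at h1
  rw [norm_mul, norm_mul, Complex.norm_cpow_eq_rpow_re_of_pos ht, Complex.norm_exp]
  calc t ^ (z - 1).re * (Real.exp (n * (-t : ℂ)).re * ‖pFun f (-t)‖)
      ≤ t ^ (z - 1).re * (Real.exp (n * (-t : ℂ)).re * (C * Real.exp (R * t))) := by gcongr
    _ = C * (t ^ (z.re - 1) * (Real.exp (-(n * t)) * Real.exp (R * t))) := by
        simp; ring
    _ = _ := by rw [← Real.exp_add]; congr 3; ring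

lemma integrableOn_cpow_mul_exp_mul_pFun (hC : 0 ≤ C) (hR : 0 ≤ R) (hRn : R < n)
    (h : ∀ k, ‖pNum f k‖ ≤ C * R ^ k) (hz : 0 < z.re) :
    IntegrableOn (fun t : ℝ => (t : ℂ) ^ (z - 1) * (Complex.exp (n * (-t : ℂ)) * pFun f (-t)))
      (Ioi 0) := by
  refine Integrable.mono' ((integrableOn_rpow_mul_exp_neg hz (sub_pos.2 hRn)).const_mul C) ?_ ?_
  · refine ContinuousOn.aestronglyMeasurable ?_ measurableSet_Ioi
    have := (differentiable_pFun hC hR h).continuous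
    exact (continuousOn_cpow_sub_one z).mul (by fun_prop)
  · filter_upwards [ae_restrict_mem measurableSet_Ioi] with t ht
    exact norm_cpow_mul_exp_mul_pFun_le h z n ht

lemma integral_norm_cpow_mul_exp_mul_pFun_le (hC : 0 ≤ C) (hR : 0 ≤ R) (hRn : R < n)
    (h : ∀ k, ‖pNum f k‖ ≤ C * R ^ k) (hz : 0 < z.re) :
    ∫ t in Ioi (0 : ℝ), ‖(t : ℂ) ^ (z - 1) * (Complex.exp (n * (-t : ℂ)) * pFun f (-t))‖
      ≤ C * ((1 / (n - R)) ^ z.re * Real.Gamma z.re) := by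
  rw [← Real.integral_rpow_mul_exp_neg_mul_Ioi hz (sub_pos.2 hRn), ← integral_const_mul]
  refine setIntegral_mono_on (integrableOn_cpow_mul_exp_mul_pFun hC hR hRn h hz).norm
    ((integrableOn_rpow_mul_exp_neg hz (sub_pos.2 hRn)).const_mul C) measurableSet_Ioi ?_
  exact fun t ht => norm_cpow_mul_exp_mul_pFun_le h z n ht

/-- A Gamma integral at `z + k`; the sign of `(-t)^k` is the one carried by `binom(-z, k)`. -/
lemma integral_cpow_mul_exp_mul_term (hn : 0 < n) (hz : 0 < z.re) (k : ℕ) :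
    ∫ t in Ioi (0 : ℝ), (t : ℂ) ^ (z - 1) *
        (Complex.exp (n * (-t : ℂ)) * (pNum f k / (k.factorial : ℂ) * (-t : ℂ) ^ k))
      = Complex.Gamma z * genPowTerm f n (-z) k := by
  have hzk : 0 < (z + k).re := by
    simp only [Complex.add_re, Complex.natCast_re]; positivity
  have hn' : (n : ℂ) ≠ 0 := Nat.cast_ne_zero.2 hn.ne'
  calc _ = ∫ t in Ioi (0 : ℝ), (pNum f k / (k.factorial : ℂ) * (-1) ^ k) *
        ((t : ℂ) ^ (z + k - 1) * Complex.exp (-(((n : ℝ) : ℂ) * t))) := by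
        refine setIntegral_congr_fun measurableSet_Ioi fun t ht => ?_
        have ht' : (t : ℂ) ≠ 0 := Complex.ofReal_ne_zero.2 (ne_of_gt ht)
        have : z + k - 1 = z - 1 + k := by ring
        simp only [this, Complex.cpow_add _ _ ht', Complex.cpow_natCast, neg_pow (t : ℂ) k,
          Complex.ofReal_natCast, mul_neg]
        ring
    _ = _ := by
        rw [integral_const_mul,
          Complex.integral_cpow_mul_exp_neg_mul_Ioi hzk (by exact_mod_cast hn), genPowTerm,
          mul_assoc, mul_left_comm (Complex.Gamma z), mul_comm (Complex.Gamma z), ← mul_assoc]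
        have h1 := choose_neg_mul_Gamma hz k
        have h2 : (1 / ((n : ℝ) : ℂ)) ^ (z + k) = (n : ℂ) ^ (-z - k) := by
          rw [one_div, Complex.ofReal_natCast, Complex.inv_cpow _ _ (by
            rw [Complex.natCast_arg]; exact Real.pi_pos.ne), ← Complex.cpow_neg]
          congr 1; ring
        rw [h2]
        linear_combination (-(pNum f k * (n : ℂ) ^ (-z - k))) * h1

lemma hasSum_genPowTerm (hR : 0 ≤ R) (hRn : R < n)
    (h : ∀ k, ‖pNum f k‖ ≤ C * R ^ k) (hz : 0 < z.re) :
    HasSum (fun k => Complex.Gamma z * genPowTerm f n (-z) k)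
      (∫ t in Ioi (0 : ℝ), (t : ℂ) ^ (z - 1) *
        (Complex.exp (n * (-t : ℂ)) * pFun f (-t))) := by
  have hn : 0 < n := by exact_mod_cast hR.trans_lt hRn
  simp_rw [← integral_cpow_mul_exp_mul_term (f := f) hn hz]
  have hb : ∀ t : ℝ, HasSum (fun k : ℕ => t ^ (z.re - 1) * Real.exp (-(n * t)) *
      (C * ((R * t) ^ k / k.factorial))) (C * (t ^ (z.re - 1) * Real.exp (-((n - R) * t)))) := by
    intro t
    have := (hasSum_mul_pow_div_factorial C (R * t)).mul_left
      (t ^ (z.re - 1) * Real.exp (-(n * t)))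
    have he : C * (t ^ (z.re - 1) * Real.exp (-((n - R) * t)))
        = t ^ (z.re - 1) * Real.exp (-(n * t)) * (C * Real.exp (R * t)) := by
      rw [show -((n - R) * t) = -(n * t) + R * t by ring, Real.exp_add]
      ring
    rwa [he]
  refine hasSum_integral_of_dominated_convergence
    (fun k t => t ^ (z.re - 1) * Real.exp (-(n * t)) * (C * ((R * t) ^ k / k.factorial)))
    (fun k => ?_) (fun k => ?_) (ae_of_all _ fun t => (hb t).summable) ?_ (ae_of_all _ fun t => ?_)
  · refine ContinuousOn.aestronglyMeasurable ?_ measurableSet_Ioi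
    exact (continuousOn_cpow_sub_one z).mul (by fun_prop)
  · filter_upwards [ae_restrict_mem measurableSet_Ioi] with t ht
    have ht : 0 < t := ht
    have h1 := norm_pNum_div_factorial_mul_pow_le h (-(t : ℂ)) k
    rw [norm_neg, Complex.norm_real, Real.norm_of_nonneg ht.le] at h1
    rw [norm_mul, norm_mul, Complex.norm_cpow_eq_rpow_re_of_pos ht, Complex.norm_exp, ← mul_assoc]
    have h2 : (n * (-t : ℂ)).re = -(n * t) := by simp
    rw [h2, Complex.sub_re, Complex.one_re]
    gcongr
  · simp_rw [(hb _).tsum_eq]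
    exact (integrableOn_rpow_mul_exp_neg hz (sub_pos.2 hRn)).const_mul C
  · exact ((hasSum_pFun h _).mul_left _).mul_left _

lemma summable_genPowTerm (hR : 0 ≤ R) (hRn : R < n)
    (h : ∀ k, ‖pNum f k‖ ≤ C * R ^ k) (hz : 0 < z.re) :
    Summable (genPowTerm f n (-z)) :=
  (summable_mul_left_iff (Complex.Gamma_ne_zero_of_re_pos hz)).1
    (hasSum_genPowTerm hR hRn h hz).summable

/-- `Γ(z) n^{(-z,f)}` is the Mellin transform of `e^{-nt} p_f(-t)`. -/
lemma Gamma_mul_genPow (hR : 0 ≤ R) (hRn : R < n)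
    (h : ∀ k, ‖pNum f k‖ ≤ C * R ^ k) (hz : 0 < z.re) :
    Complex.Gamma z * genPow f n (-z) = ∫ t in Ioi (0 : ℝ), (t : ℂ) ^ (z - 1) *
        (Complex.exp (n * (-t : ℂ)) * pFun f (-t)) := by
  rw [genPow, ← tsum_mul_left]
  exact (hasSum_genPowTerm hR hRn h hz).tsum_eq

end Laplace

/-! ### Summation over `n`. -/

/-- `e^{n_f s} p_f(s) / (1 - e^s)`. -/
noncomputable def hankelKernel (f : ℝ → ℂ) (s : ℂ) : ℂ :=
  Complex.exp (nIdx f * s) * pFun f s / (1 - Complex.exp s)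

section Series

variable {f : ℝ → ℂ} {C R : ℝ} {z : ℂ}

lemma hasSum_Gamma_mul_genPow (hC : 0 ≤ C) (hR : 0 ≤ R) (hRn : R < nIdx f)
    (h : ∀ k, ‖pNum f k‖ ≤ C * R ^ k) (hz : 1 < z.re) :
    HasSum (fun m : ℕ => Complex.Gamma z * genPow f ((m + nIdx f : ℕ) : ℂ) (-z))
      (mellin (fun t : ℝ => hankelKernel f (-t)) z) := by
  have hz0 : 0 < z.re := zero_lt_one.trans hz
  have hRm : ∀ m : ℕ, R < ((m + nIdx f : ℕ) : ℝ) := fun m => by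
    push_cast; have : (0 : ℝ) ≤ m := m.cast_nonneg
    linarith
  simp_rw [fun m => Gamma_mul_genPow hR (hRm m) h hz0]
  have key : mellin (fun t : ℝ => hankelKernel f (-t)) z = ∫ t in Ioi (0 : ℝ), ∑' m : ℕ,
      (t : ℂ) ^ (z - 1) * (Complex.exp ((m + nIdx f : ℕ) * (-t : ℂ)) * pFun f (-t)) := by
    refine setIntegral_congr_fun measurableSet_Ioi fun t ht => ?_
    have ht : 0 < t := ht
    have hlt : ‖Complex.exp (-t : ℂ)‖ < 1 := by
      rw [Complex.norm_exp]; simpa using ht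
    have := (((hasSum_geometric_of_norm_lt_one hlt).mul_right
      (Complex.exp (nIdx f * (-t : ℂ)) * pFun f (-t))).mul_left ((t : ℂ) ^ (z - 1))).tsum_eq
    have hm : ∀ m : ℕ, Complex.exp ((m + nIdx f : ℕ) * (-t : ℂ))
        = Complex.exp (-t : ℂ) ^ m * Complex.exp (nIdx f * (-t : ℂ)) := fun m => by
      rw [Nat.cast_add, add_mul, Complex.exp_add, Complex.exp_nat_mul]
    simp only [smul_eq_mul, hankelKernel, hm, mul_assoc]
    rw [this, div_eq_inv_mul]
  rw [key]
  refine hasSum_integral_of_summable_integral_norm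
    (fun m => integrableOn_cpow_mul_exp_mul_pFun hC hR (hRm m) h hz0) ?_
  refine Summable.of_nonneg_of_le (fun m => integral_nonneg fun t => norm_nonneg _)
    (fun m => integral_norm_cpow_mul_exp_mul_pFun_le hC hR (hRm m) h hz0) ?_
  refine (Summable.mul_right _ ?_).mul_left _
  -- The integrals of the norms are dominated by a shifted `p`-series with exponent `Re z`, hence
  -- the condition `Re z > 1`.
  have := (Real.summable_one_div_nat_add_rpow (nIdx f - R) z.re).2 hz
  refine this.congr fun m => ?_
  have h0 : 0 < m + (nIdx f - R) := by have := hRm m; push_cast at this; linarith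
  rw [abs_of_pos h0, Nat.cast_add, ← add_sub_assoc, Real.div_rpow zero_le_one (by linarith),
    Real.one_rpow]

lemma summable_genPow (hC : 0 ≤ C) (hR : 0 ≤ R) (hRn : R < nIdx f)
    (h : ∀ k, ‖pNum f k‖ ≤ C * R ^ k) (hz : 1 < z.re) :
    Summable fun m : ℕ => genPow f ((m + nIdx f : ℕ) : ℂ) (-z) :=
  (summable_mul_left_iff (Complex.Gamma_ne_zero_of_re_pos (zero_lt_one.trans hz))).1
    (hasSum_Gamma_mul_genPow hC hR hRn h hz).summable

lemma Gamma_mul_LC (hC : 0 ≤ C) (hR : 0 ≤ R) (hRn : R < nIdx f)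
    (h : ∀ k, ‖pNum f k‖ ≤ C * R ^ k) (hz : 1 < z.re) :
    Complex.Gamma z * LC f z = mellin (fun t : ℝ => hankelKernel f (-t)) z := by
  rw [LC, ← tsum_mul_left]
  exact (hasSum_Gamma_mul_genPow hC hR hRn h hz).tsum_eq

end Series

/-! ### The pole at `0` and the integrand on the contour. -/

lemma dslope_exp_zero_ne_zero {s : ℂ} (hs : ‖s‖ < 2 * π) : dslope Complex.exp 0 s ≠ 0 := by
  rcases eq_or_ne s 0 with rfl | h0
  · simp
  intro h
  have h1 := sub_smul_dslope Complex.exp 0 s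
  rw [h, smul_zero, Complex.exp_zero, eq_comm, sub_eq_zero, Complex.exp_eq_one_iff] at h1
  obtain ⟨n, rfl⟩ := h1
  have hn : n ≠ 0 := by rintro rfl; simp at h0
  have hn1 : (1 : ℝ) ≤ |(n : ℝ)| := by exact_mod_cast Int.one_le_abs hn
  have hpi := Real.pi_pos
  simp only [norm_mul, Complex.norm_intCast, Complex.norm_ofNat, Complex.norm_real,
    Complex.norm_I, mul_one, Real.norm_of_nonneg hpi.le] at hs
  nlinarith

/-- The function `-s e^{n_f s} p_f(s) / (1 - e^s)`, continued analytically to `s = 0`. -/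
noncomputable def regularPart (f : ℝ → ℂ) (s : ℂ) : ℂ :=
  Complex.exp (nIdx f * s) * pFun f s / dslope Complex.exp 0 s

/-- No exception is needed at `s = 0`, where both sides vanish because `x / 0 = 0`. -/
lemma hankelKernel_eq (f : ℝ → ℂ) (s : ℂ) : hankelKernel f s = -(regularPart f s / s) := by
  have h1 := sub_smul_dslope Complex.exp 0 s
  rw [Complex.exp_zero, sub_zero, smul_eq_mul] at h1
  rw [hankelKernel, regularPart, div_div, mul_comm (dslope _ _ _), h1, ← div_neg, neg_sub]

lemma rayIntegrand_eq (f : ℝ → ℂ) (z : ℂ) (θ t : ℝ) :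
    rayIntegrand f z θ t = Complex.exp (θ * Complex.I * z) *
      ((t : ℂ) ^ (z - 1) * hankelKernel f (t * Complex.exp (θ * Complex.I))) := by
  have : Complex.exp (θ * Complex.I * z)
      = Complex.exp (θ * Complex.I * (z - 1)) * Complex.exp (θ * Complex.I) := by
    rw [← Complex.exp_add]; congr 1; ring
  rw [rayIntegrand, integrand, hankelKernel, this]
  ring

lemma rayIntegrand_pi (f : ℝ → ℂ) (z : ℂ) (t : ℝ) :
    rayIntegrand f z π t = Complex.exp (π * Complex.I * z) *
      ((t : ℂ) ^ (z - 1) * hankelKernel f (-t)) := by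
  rw [rayIntegrand_eq, Complex.exp_pi_mul_I, mul_neg_one]

lemma rayIntegrand_neg_pi (f : ℝ → ℂ) (z : ℂ) (t : ℝ) :
    rayIntegrand f z (-π) t = Complex.exp (-(π * Complex.I * z)) *
      ((t : ℂ) ^ (z - 1) * hankelKernel f (-t)) := by
  have : Complex.exp ((-π : ℝ) * Complex.I) = -1 := by
    rw [Complex.ofReal_neg, neg_mul, Complex.exp_neg, Complex.exp_pi_mul_I]; norm_num
  rw [rayIntegrand_eq, this, mul_neg_one, Complex.ofReal_neg, neg_mul, neg_mul]

/-- On the circle `ds = i s dθ`, and the factor `s` cancels the simple pole of the kernel. -/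
lemma circleIntegrand_eq (f : ℝ → ℂ) (z : ℂ) {ε : ℝ} (hε : 0 < ε) (θ : ℝ) :
    circleIntegrand f z ε θ = -Complex.I * (ε : ℂ) ^ (z - 1) *
      (Complex.exp (θ * Complex.I * (z - 1)) *
        regularPart f (ε * Complex.exp (θ * Complex.I))) := by
  have h := hankelKernel_eq f (ε * Complex.exp (θ * Complex.I))
  have hne : (ε : ℂ) * Complex.exp (θ * Complex.I) ≠ 0 :=
    mul_ne_zero (Complex.ofReal_ne_zero.2 hε.ne') (Complex.exp_ne_zero _)
  rw [eq_comm, neg_eq_iff_eq_neg, div_eq_iff hne] at h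
  rw [h, circleIntegrand, integrand, hankelKernel]
  ring

lemma differentiable_integral_exp_mul {g : ℝ → ℂ} (hg : Continuous g) (a b : ℝ) :
    Differentiable ℂ fun z : ℂ => ∫ θ in a..b, Complex.exp (θ * Complex.I * z) * g θ := by
  intro z
  have hm : ∀ w : ℂ, Continuous fun θ : ℝ => Complex.exp (θ * Complex.I * w) * g θ :=
    fun w => by fun_prop
  refine (intervalIntegral.hasDerivAt_integral_of_dominated_loc_of_deriv_le
    (s := Metric.ball z 1)
    (F' := fun w θ => Complex.exp (θ * Complex.I * w) * (θ * Complex.I) * g θ)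
    (bound := fun θ => Real.exp (|θ| * (‖z‖ + 1)) * |θ| * ‖g θ‖)
    (Metric.ball_mem_nhds z one_pos) (Eventually.of_forall fun w =>
      (hm w).aestronglyMeasurable) ((hm z).intervalIntegrable a b)
    (Continuous.aestronglyMeasurable (by fun_prop)) (ae_of_all _ fun θ _ w hw => ?_)
    (Continuous.intervalIntegrable (by fun_prop) a b)
    (ae_of_all _ fun θ _ w _ => ?_)).2.differentiableAt
  · have hw' : ‖w‖ ≤ ‖z‖ + 1 := by
      have h1 := norm_sub_norm_le w z
      have h2 := mem_ball_iff_norm.1 hw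
      linarith
    rw [norm_mul, norm_mul, norm_mul, Complex.norm_I, mul_one, Complex.norm_real, Real.norm_eq_abs]
    gcongr
    refine (Complex.norm_exp_le_exp_norm _).trans ?_
    rw [norm_mul, norm_mul, Complex.norm_I, mul_one, Complex.norm_real, Real.norm_eq_abs]
    gcongr
  · have := ((hasDerivAt_id w).const_mul (θ * Complex.I)).cexp.mul_const (g θ)
    simpa using this

/-! ### Size of the kernel on the cut, and holomorphy of the ray integrals. -/

section Bounds

variable {f : ℝ → ℂ} {C R : ℝ}

lemma differentiableOn_regularPart (hp : Differentiable ℂ (pFun f)) :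
    DifferentiableOn ℂ (regularPart f) (Metric.ball 0 (2 * π)) := by
  refine DifferentiableOn.div (by fun_prop) ?_ fun s hs =>
    dslope_exp_zero_ne_zero (mem_ball_zero_iff.1 hs)
  exact (Complex.differentiableOn_dslope (Metric.ball_mem_nhds 0 (by positivity))).2
    Complex.differentiable_exp.differentiableOn

lemma continuousOn_hankelKernel_neg (hp : Differentiable ℂ (pFun f)) :
    ContinuousOn (fun t : ℝ => hankelKernel f (-t)) (Ioi 0) := by
  have := hp.continuous
  refine ContinuousOn.div (by fun_prop) (by fun_prop) fun t ht h => ?_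
  have ht : 0 < t := ht
  have h1 := congrArg norm (sub_eq_zero.1 h)
  rw [Complex.norm_exp, norm_one, eq_comm, Real.exp_eq_one_iff] at h1
  simp at h1
  exact ht.ne' h1

lemma isBigO_hankelKernel_neg_atTop (hC : 0 ≤ C) (h : ∀ k, ‖pNum f k‖ ≤ C * R ^ k) :
    (fun t : ℝ => hankelKernel f (-t)) =O[atTop] fun t => Real.exp (-(nIdx f - R) * t) := by
  -- For `t ≥ 1` the denominator satisfies `|1 - e^{-t}| ≥ 1 - e^{-1}`.
  refine Asymptotics.IsBigO.of_bound (C / (1 - Real.exp (-1))) ?_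
  filter_upwards [eventually_ge_atTop 1] with t ht
  have ht0 : 0 ≤ t := zero_le_one.trans ht
  have hpos : 0 < 1 - Real.exp (-1) := by
    rw [sub_pos, Real.exp_lt_one_iff]; norm_num
  have h1 := norm_pFun_le h (-(t : ℂ))
  rw [norm_neg, Complex.norm_real, Real.norm_of_nonneg ht0] at h1
  have h2 : 1 - Real.exp (-1) ≤ ‖1 - Complex.exp (-t : ℂ)‖ := by
    have := norm_sub_norm_le (1 : ℂ) (Complex.exp (-t : ℂ))
    rw [norm_one, Complex.norm_exp] at this
    refine le_trans ?_ this
    have : Real.exp (-t : ℂ).re ≤ Real.exp (-1) := Real.exp_le_exp.2 (by simpa using ht)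
    linarith
  rw [hankelKernel, norm_div, norm_mul, Complex.norm_exp, Real.norm_of_nonneg (Real.exp_pos _).le]
  have h3 : (nIdx f * (-t : ℂ)).re = -(nIdx f * t) := by simp
  have h4 : -(nIdx f - R) * t = -(nIdx f * t) + R * t := by ring
  rw [h3, h4, Real.exp_add, div_mul_eq_mul_div]
  refine div_le_div₀ (by positivity) ?_ hpos h2
  calc _ ≤ Real.exp (-(nIdx f * t)) * (C * Real.exp (R * t)) := by gcongr
    _ = _ := by ring

lemma isBigO_hankelKernel_neg_zero (hp : Differentiable ℂ (pFun f)) :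
    (fun t : ℝ => hankelKernel f (-t)) =O[𝓝[>] 0] fun t => t ^ (-1 : ℝ) := by
  have hc : ContinuousAt (regularPart f) 0 :=
    ((differentiableOn_regularPart hp).differentiableAt
      (Metric.ball_mem_nhds 0 (by positivity))).continuousAt
  have ht : Tendsto (fun t : ℝ => -(t : ℂ)) (𝓝[>] 0) (𝓝 0) := by
    have : Continuous fun t : ℝ => -(t : ℂ) := by fun_prop
    simpa using (this.tendsto 0).mono_left nhdsWithin_le_nhds
  have h1 := (hc.tendsto.comp ht).isBigO_one ℝ
  have h2 := h1.norm_left.mul (Asymptotics.isBigO_refl (fun t : ℝ => t ^ (-1 : ℝ)) (𝓝[>] 0))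
  simp only [one_mul] at h2
  refine (Asymptotics.IsBigO.of_bound 1 ?_).trans h2
  filter_upwards [self_mem_nhdsWithin] with t ht
  have ht : 0 < t := ht
  rw [hankelKernel_eq, norm_neg, norm_div, norm_mul, norm_neg, Complex.norm_real, norm_norm, Real.rpow_neg_one,
    norm_inv, one_mul, div_eq_mul_inv]
  exact le_rfl

lemma mellinConvergent_hankelKernel_neg (hp : Differentiable ℂ (pFun f)) (hC : 0 ≤ C)
    (hRn : R < nIdx f) (h : ∀ k, ‖pNum f k‖ ≤ C * R ^ k) {z : ℂ} (hz : 1 < z.re) :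
    MellinConvergent (fun t : ℝ => hankelKernel f (-t)) z :=
  mellinConvergent_of_isBigO_rpow_exp (sub_pos.2 hRn)
    ((continuousOn_hankelKernel_neg hp).locallyIntegrableOn measurableSet_Ioi)
    (isBigO_hankelKernel_neg_atTop hC h) (isBigO_hankelKernel_neg_zero hp) hz

/-- Cutting the kernel off below `ε` makes the ray integral a Mellin transform of a function
vanishing near `0`. Its half-plane of convergence is all of `ℂ`, which yields both integrability and
holomorphy for every `z`. -/
lemma locallyIntegrableOn_indicator_hankelKernel_neg (hp : Differentiable ℂ (pFun f)) (ε : ℝ) :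
    LocallyIntegrableOn ((Ioi ε).indicator fun t : ℝ => hankelKernel f (-t)) (Ioi 0) :=
  fun x hx => by
    obtain ⟨s, hs, hi⟩ := (continuousOn_hankelKernel_neg hp).locallyIntegrableOn
      (μ := volume) measurableSet_Ioi x hx
    exact ⟨s, hs, hi.indicator measurableSet_Ioi⟩

lemma isBigO_indicator_hankelKernel_neg_atTop (hC : 0 ≤ C) (h : ∀ k, ‖pNum f k‖ ≤ C * R ^ k)
    (ε : ℝ) : ((Ioi ε).indicator fun t : ℝ => hankelKernel f (-t))
      =O[atTop] fun t => Real.exp (-(nIdx f - R) * t) :=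
  (isBigO_hankelKernel_neg_atTop hC h).congr'
    ((eventually_gt_atTop ε).mono fun _ ht =>
      (indicator_of_mem (mem_Ioi.2 ht) fun t : ℝ => hankelKernel f (-t)).symm)
    EventuallyEq.rfl

lemma isBigO_indicator_hankelKernel_neg_zero {ε : ℝ} (hε : 0 < ε) (b : ℝ) :
    ((Ioi ε).indicator fun t : ℝ => hankelKernel f (-t)) =O[𝓝[>] 0] fun t => t ^ (-b) := by
  refine (Asymptotics.isBigO_zero (fun t : ℝ => t ^ (-b)) _).congr' ?_ EventuallyEq.rfl
  filter_upwards [nhdsWithin_le_nhds (Iio_mem_nhds hε)] with t ht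
  exact (indicator_of_notMem (notMem_Ioi.2 (mem_Iio.1 ht).le) _).symm

lemma indicator_cpow_mul (f : ℝ → ℂ) (z : ℂ) (ε : ℝ) :
    (fun t : ℝ => (t : ℂ) ^ (z - 1) •
      ((Ioi ε).indicator fun t : ℝ => hankelKernel f (-t)) t) =
    (Ioi ε).indicator fun t : ℝ => (t : ℂ) ^ (z - 1) * hankelKernel f (-t) := by
  ext t
  by_cases ht : t ∈ Ioi ε <;> simp [indicator, ht]

lemma integrableOn_cpow_mul_hankelKernel_neg (hp : Differentiable ℂ (pFun f)) (hC : 0 ≤ C)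
    (hRn : R < nIdx f) (h : ∀ k, ‖pNum f k‖ ≤ C * R ^ k) {ε : ℝ} (hε : 0 < ε) (z : ℂ) :
    IntegrableOn (fun t : ℝ => (t : ℂ) ^ (z - 1) * hankelKernel f (-t)) (Ioi ε) := by
  have := mellinConvergent_of_isBigO_rpow_exp (b := z.re - 1) (sub_pos.2 hRn)
    (locallyIntegrableOn_indicator_hankelKernel_neg hp ε)
    (isBigO_indicator_hankelKernel_neg_atTop hC h ε)
    (isBigO_indicator_hankelKernel_neg_zero hε _) (sub_one_lt z.re)
  rwa [MellinConvergent, indicator_cpow_mul, IntegrableOn, integrable_indicator_iff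
    measurableSet_Ioi, IntegrableOn, Measure.restrict_restrict measurableSet_Ioi,
    Ioi_inter_Ioi, sup_eq_left.2 hε.le] at this

lemma differentiable_integral_cpow_mul_hankelKernel_neg (hp : Differentiable ℂ (pFun f))
    (hC : 0 ≤ C) (hRn : R < nIdx f) (h : ∀ k, ‖pNum f k‖ ≤ C * R ^ k) {ε : ℝ} (hε : 0 < ε) :
    Differentiable ℂ fun z : ℂ =>
      ∫ t in Ioi ε, (t : ℂ) ^ (z - 1) * hankelKernel f (-t) := by
  have hm : (fun z : ℂ => ∫ t in Ioi ε, (t : ℂ) ^ (z - 1) * hankelKernel f (-t)) =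
      mellin ((Ioi ε).indicator fun t : ℝ => hankelKernel f (-t)) := by
    ext z
    rw [mellin, indicator_cpow_mul, integral_indicator measurableSet_Ioi,
      Measure.restrict_restrict measurableSet_Ioi, Ioi_inter_Ioi, sup_eq_left.2 hε.le]
  rw [hm]
  exact fun z => mellin_differentiableAt_of_isBigO_rpow_exp (b := z.re - 1) (sub_pos.2 hRn)
    (locallyIntegrableOn_indicator_hankelKernel_neg hp ε)
    (isBigO_indicator_hankelKernel_neg_atTop hC h ε)
    (isBigO_indicator_hankelKernel_neg_zero hε _) (sub_one_lt z.re)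

lemma continuous_regularPart_circle (hp : Differentiable ℂ (pFun f)) {ε : ℝ} (hε : 0 < ε)
    (hε' : ε < 2 * π) :
    Continuous fun θ : ℝ => regularPart f (ε * Complex.exp (θ * Complex.I)) := by
  refine (differentiableOn_regularPart hp).continuousOn.comp_continuous (by fun_prop) fun θ => ?_
  rw [mem_ball_zero_iff, norm_mul, Complex.norm_exp_ofReal_mul_I, Complex.norm_real,
    Real.norm_of_nonneg hε.le, mul_one]
  exact hε'

end Bounds

/-! ### Circle against cut, coefficient by coefficient. -/

section PowerSeries

variable {H : ℂ → ℂ} {h : ℕ → ℂ} {r ε : ℝ} {z : ℂ}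

lemma summable_norm_mul_pow_of_hasSum (hε : 0 < ε) (hεr : ε < r)
    (hH : ∀ s ∈ Metric.ball (0 : ℂ) r, HasSum (fun k => h k * s ^ k) (H s)) :
    Summable fun k => ‖h k‖ * ε ^ k := by
  have := (hH ε (by simpa [abs_of_pos hε] using hεr)).summable.norm
  refine this.congr fun k => ?_
  rw [norm_mul, norm_pow, Complex.norm_real, Real.norm_of_nonneg hε.le]

lemma hasSum_integral_exp_mul_circle (hε : 0 < ε) (hεr : ε < r)
    (hH : ∀ s ∈ Metric.ball (0 : ℂ) r, HasSum (fun k => h k * s ^ k) (H s)) (w : ℂ) :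
    HasSum (fun k : ℕ => ∫ θ in (-π)..π, Complex.exp (θ * Complex.I * w) *
        (h k * (ε * Complex.exp (θ * Complex.I)) ^ k))
      (∫ θ in (-π)..π, Complex.exp (θ * Complex.I * w) *
        H (ε * Complex.exp (θ * Complex.I))) := by
  have hs := summable_norm_mul_pow_of_hasSum hε hεr hH
  have hnorm : ∀ θ : ℝ, ‖(ε : ℂ) * Complex.exp (θ * Complex.I)‖ = ε := fun θ => by
    rw [norm_mul, Complex.norm_exp_ofReal_mul_I, Complex.norm_real, Real.norm_of_nonneg hε.le,
      mul_one]
  refine intervalIntegral.hasSum_integral_of_dominated_convergence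
    (fun k θ => ‖Complex.exp (θ * Complex.I * w)‖ * (‖h k‖ * ε ^ k))
    (fun k => Continuous.aestronglyMeasurable (by fun_prop))
    (fun k => ae_of_all _ fun θ _ => ?_) (ae_of_all _ fun θ _ => hs.mul_left _) ?_
    (ae_of_all _ fun θ _ => (hH _ ?_).mul_left _)
  · rw [norm_mul, norm_mul, norm_pow, hnorm]
  · simp_rw [tsum_mul_left]
    exact Continuous.intervalIntegrable (by fun_prop) _ _
  · rwa [mem_ball_zero_iff, hnorm]

lemma hasSum_integral_cpow_mul_segment (hε : 0 < ε) (hεr : ε < r)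
    (hH : ∀ s ∈ Metric.ball (0 : ℂ) r, HasSum (fun k => h k * s ^ k) (H s)) (hz : 1 < z.re) :
    HasSum (fun k : ℕ => ∫ t in (0 : ℝ)..ε, (t : ℂ) ^ (z - 2) * (h k * (-t : ℂ) ^ k))
      (∫ t in (0 : ℝ)..ε, (t : ℂ) ^ (z - 2) * H (-t)) := by
  have hs := summable_norm_mul_pow_of_hasSum hε hεr hH
  refine intervalIntegral.hasSum_integral_of_dominated_convergence
    (fun k t => t ^ (z.re - 2) * (‖h k‖ * ε ^ k)) (fun k => ?_)
    (fun k => ae_of_all _ fun t ht => ?_) (ae_of_all _ fun t _ => hs.mul_left _) ?_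
    (ae_of_all _ fun t ht => (hH _ ?_).mul_left _)
  · rw [uIoc_of_le hε.le]
    refine ContinuousOn.aestronglyMeasurable ?_ measurableSet_Ioc
    refine ContinuousOn.mul (fun t ht => ?_) (by fun_prop)
    exact (Complex.continuousAt_ofReal_cpow_const t _ (Or.inr ht.1.ne')).continuousWithinAt
  · rw [uIoc_of_le hε.le] at ht
    have ht0 := ht.1
    rw [norm_mul, norm_mul, norm_pow, norm_neg, Complex.norm_cpow_eq_rpow_re_of_pos ht0,
      Complex.norm_real, Real.norm_of_nonneg ht0.le, Complex.sub_re, Complex.re_ofNat]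
    have := ht.2
    gcongr
  · simp_rw [tsum_mul_left]
    exact (intervalIntegral.intervalIntegrable_rpow' (by linarith)).mul_const _
  · rw [uIoc_of_le hε.le] at ht
    rw [mem_ball_zero_iff, norm_neg, Complex.norm_real, Real.norm_of_nonneg ht.1.le]
    exact ht.2.trans_lt hεr

lemma sin_pi_mul_sub_one_add (z : ℂ) (k : ℕ) :
    Complex.sin (π * (z - 1 + k)) = -((-1) ^ k * Complex.sin (π * z)) := by
  rw [show (π : ℂ) * (z - 1 + k) = π * z - π + k * π by ring,
    Complex.sin_antiperiodic.add_nat_mul_eq, Complex.sin_sub_pi]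
  ring

/-- With `w = z - 1 + k ≠ 0`, the integral of `e^{iwθ}` is `2 sin(πw) / w`, and shifting by integers
reduces the sine to `sin(πz)` up to sign. -/
lemma integral_exp_mul_circle_term (hz : 1 < z.re) (a : ℂ) (ε : ℝ) (k : ℕ) :
    ∫ θ in (-π)..π, Complex.exp (θ * Complex.I * (z - 1)) *
        (a * (ε * Complex.exp (θ * Complex.I)) ^ k)
      = -(2 * Complex.sin (π * z)) * (a * (-ε) ^ k / (z - 1 + k)) := by
  have hne : z - 1 + k ≠ 0 := fun h => by
    have := congrArg Complex.re h
    simp at this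
    have : (0 : ℝ) ≤ k := k.cast_nonneg
    linarith
  have h1 : ∀ θ : ℝ, Complex.exp (θ * Complex.I * (z - 1)) *
      (a * (ε * Complex.exp (θ * Complex.I)) ^ k)
        = a * ε ^ k * Complex.exp (Complex.I * (z - 1 + k) * θ) := fun θ => by
    rw [mul_pow, ← Complex.exp_nat_mul, show Complex.I * (z - 1 + k) * (θ : ℂ)
      = θ * Complex.I * (z - 1) + k * (θ * Complex.I) by ring, Complex.exp_add]
    ring
  have h2 := Complex.two_sin (π * (z - 1 + k))
  rw [sin_pi_mul_sub_one_add] at h2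
  have h3 : Complex.exp (π * (z - 1 + k) * Complex.I) - Complex.exp (-(π * (z - 1 + k)) * Complex.I)
      = -(2 * Complex.I * ((-1) ^ k * Complex.sin (π * z))) := by
    linear_combination -Complex.I * h2 + (Complex.exp (π * (z - 1 + k) * Complex.I)
      - Complex.exp (-(π * (z - 1 + k)) * Complex.I)) * Complex.I_sq
  have e1 : Complex.I * (z - 1 + k) * ((-π : ℝ) : ℂ) = -(π * (z - 1 + k)) * Complex.I := by
    push_cast; ring
  have e2 : Complex.I * (z - 1 + k) * (π : ℂ) = π * (z - 1 + k) * Complex.I := by ring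
  simp_rw [h1]
  rw [intervalIntegral.integral_const_mul,
    integral_exp_mul_complex (mul_ne_zero Complex.I_ne_zero hne), e1, e2, neg_pow (ε : ℂ)]
  have hI := Complex.I_ne_zero
  rw [h3]
  field_simp

lemma integral_cpow_mul_segment_term (hε : 0 < ε) (hz : 1 < z.re) (a : ℂ) (k : ℕ) :
    ∫ t in (0 : ℝ)..ε, (t : ℂ) ^ (z - 2) * (a * (-t : ℂ) ^ k)
      = (ε : ℂ) ^ (z - 1) * (a * (-ε) ^ k / (z - 1 + k)) := by
  have hk : (0 : ℝ) ≤ k := k.cast_nonneg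
  have hne : z - 1 + k ≠ 0 := fun h => by
    have := congrArg Complex.re h
    simp at this
    linarith
  have hre : -1 < (z - 2 + k).re := by simp; linarith
  calc _ = ∫ t in (0 : ℝ)..ε, (a * (-1) ^ k) * (t : ℂ) ^ (z - 2 + k) := by
        refine intervalIntegral.integral_congr_ae (ae_of_all _ fun t ht => ?_)
        rw [uIoc_of_le hε.le] at ht
        rw [Complex.cpow_add _ _ (Complex.ofReal_ne_zero.2 ht.1.ne'), Complex.cpow_natCast,
          neg_pow (t : ℂ)]
        ring
    _ = _ := by
        have e : z - 2 + k + 1 = z - 1 + k := by ring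
        rw [intervalIntegral.integral_const_mul, integral_cpow (Or.inl hre), e, Complex.ofReal_zero,
          Complex.zero_cpow hne, Complex.cpow_add _ _ (Complex.ofReal_ne_zero.2 hε.ne'),
          Complex.cpow_natCast, neg_pow (ε : ℂ)]
        ring

/-- The integral of `s^{z-2} H(s)` over a circle cut at the negative axis, as an integral over
the cut. -/
lemma integral_exp_mul_circle_eq (hε : 0 < ε) (hεr : ε < r)
    (hH : ∀ s ∈ Metric.ball (0 : ℂ) r, HasSum (fun k => h k * s ^ k) (H s)) (hz : 1 < z.re) :
    (ε : ℂ) ^ (z - 1) * ∫ θ in (-π)..π, Complex.exp (θ * Complex.I * (z - 1)) *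
        H (ε * Complex.exp (θ * Complex.I))
      = -(2 * Complex.sin (π * z)) * ∫ t in (0 : ℝ)..ε, (t : ℂ) ^ (z - 2) * H (-t) := by
  have h1 := (hasSum_integral_exp_mul_circle hε hεr hH (z - 1)).mul_left ((ε : ℂ) ^ (z - 1))
  have h2 := (hasSum_integral_cpow_mul_segment hε hεr hH hz).mul_left (-(2 * Complex.sin (π * z)))
  -- Both sides are sums of the same series.
  refine h1.unique (h2.congr_fun ?_)
  intro k
  rw [integral_exp_mul_circle_term hz, integral_cpow_mul_segment_term hε hz]
  ring

end PowerSeries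

/-! ### The Hankel integral and the theorem. -/

/-- For `Re z > 1` the Hankel integral collapses onto the cut. -/
lemma hankelI_eq_mellin {f : ℝ → ℂ} {C R ε : ℝ} (hp : Differentiable ℂ (pFun f)) (hC : 0 ≤ C)
    (hRn : R < nIdx f) (h : ∀ k, ‖pNum f k‖ ≤ C * R ^ k) (hε : 0 < ε) (hε' : ε < 2 * π)
    {z : ℂ} (hz : 1 < z.re) :
    hankelI f ε z
      = Complex.sin (π * z) / π * mellin (fun t : ℝ => hankelKernel f (-t)) z := by
  have hH : ∀ s ∈ Metric.ball (0 : ℂ) (2 * π),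
      HasSum (fun k => ((k.factorial : ℂ)⁻¹ * iteratedDeriv k (regularPart f) 0) * s ^ k)
        (regularPart f s) := fun s hs => by
    refine (Complex.hasSum_taylorSeries_on_ball (differentiableOn_regularPart hp) hs).congr_fun
      fun k => ?_
    rw [sub_zero, smul_eq_mul, smul_eq_mul]
    ring
  have hcirc : ∫ θ in (-π)..π, circleIntegrand f z ε θ = 2 * Complex.I * Complex.sin (π * z) *
      ∫ t in Ioc 0 ε, (t : ℂ) ^ (z - 1) * hankelKernel f (-t) := by
    have h1 := integral_exp_mul_circle_eq hε hε' hH hz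
    have h2 : ∫ t in (0 : ℝ)..ε, (t : ℂ) ^ (z - 2) * regularPart f (-t)
        = ∫ t in Ioc 0 ε, (t : ℂ) ^ (z - 1) * hankelKernel f (-t) := by
      rw [intervalIntegral.integral_of_le hε.le]
      refine setIntegral_congr_fun measurableSet_Ioc fun t ht => ?_
      have ht0 : (t : ℂ) ≠ 0 := Complex.ofReal_ne_zero.2 ht.1.ne'
      simp only [hankelKernel_eq, show z - 1 = z - 2 + 1 by ring, Complex.cpow_add _ _ ht0,
        Complex.cpow_one]
      field_simp
    simp_rw [circleIntegrand_eq f z hε]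
    rw [intervalIntegral.integral_const_mul, mul_assoc, h1, h2]
    ring
  have hsplit : mellin (fun t : ℝ => hankelKernel f (-t)) z
      = (∫ t in Ioc 0 ε, (t : ℂ) ^ (z - 1) * hankelKernel f (-t))
        + ∫ t in Ioi ε, (t : ℂ) ^ (z - 1) * hankelKernel f (-t) := by
    have hi : IntegrableOn (fun t : ℝ => (t : ℂ) ^ (z - 1) * hankelKernel f (-t)) (Ioi 0) :=
      mellinConvergent_hankelKernel_neg hp hC hRn h hz
    rw [mellin, ← Ioc_union_Ioi_eq_Ioi hε.le]
    exact setIntegral_union (Ioc_disjoint_Ioi le_rfl) measurableSet_Ioi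
      (hi.mono_set Ioc_subset_Ioi_self) (hi.mono_set (Ioi_subset_Ioi hε.le))
  -- The phase difference of the two edges is the same factor that the circle produces, so the two
  -- pieces of the Mellin integral recombine.
  have hsin : Complex.exp (π * Complex.I * z) - Complex.exp (-(π * Complex.I * z))
      = 2 * Complex.I * Complex.sin (π * z) := by
    have h2 := Complex.two_sin (π * z)
    rw [show -(π * z : ℂ) * Complex.I = -(π * Complex.I * z) by ring,
      show (π * z : ℂ) * Complex.I = π * Complex.I * z by ring] at h2
    linear_combination -Complex.I * h2 + (Complex.exp (π * Complex.I * z)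
      - Complex.exp (-(π * Complex.I * z))) * Complex.I_sq
  have hpi : (π : ℂ) ≠ 0 := Complex.ofReal_ne_zero.2 Real.pi_ne_zero
  simp_rw [hankelI, hcirc, rayIntegrand_pi, rayIntegrand_neg_pi]
  rw [integral_const_mul, integral_const_mul, hsplit]
  set J := ∫ t in Ioi ε, (t : ℂ) ^ (z - 1) * hankelKernel f (-t)
  set K := ∫ t in Ioc 0 ε, (t : ℂ) ^ (z - 1) * hankelKernel f (-t)
  have hI := Complex.I_ne_zero
  field_simp
  linear_combination J * hsin

lemma differentiable_hankelI {f : ℝ → ℂ} {C R ε : ℝ} (hp : Differentiable ℂ (pFun f))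
    (hC : 0 ≤ C) (hRn : R < nIdx f) (h : ∀ k, ‖pNum f k‖ ≤ C * R ^ k) (hε : 0 < ε)
    (hε' : ε < 2 * π) : Differentiable ℂ (hankelI f ε) := by
  have hJ := differentiable_integral_cpow_mul_hankelKernel_neg hp hC hRn h hε
  have hc := (differentiable_integral_exp_mul
    (continuous_regularPart_circle hp hε hε') (-π) π).comp
      (differentiable_id.sub_const (1 : ℂ))
  have hpow : Differentiable ℂ fun z : ℂ => (ε : ℂ) ^ (z - 1) :=
    (differentiable_id.sub_const (1 : ℂ)).const_cpow (Or.inl (Complex.ofReal_ne_zero.2 hε.ne'))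
  unfold hankelI
  simp_rw [circleIntegrand_eq f _ hε, rayIntegrand_pi, rayIntegrand_neg_pi]
  simp_rw [integral_const_mul, intervalIntegral.integral_const_mul]
  refine Differentiable.const_mul (Differentiable.add (Differentiable.add ?_ ?_) ?_) _
  · exact (Differentiable.mul (by fun_prop) hJ).neg
  · exact (hpow.const_mul _).mul hc
  · exact Differentiable.mul (by fun_prop) hJ

end LCFunction

theorem theorem5p3 (f : ℝ → ℂ) (hf : AnalyticAt ℝ f 0) (hρ : LCFunction.rho f ≠ 0)
    (ε : ℝ) (hε : 0 < ε) (hε' : ε < 2 * Real.pi) :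
    -- the contour integral converges absolutely for every `z`
    (∀ z : ℂ,
      MeasureTheory.IntegrableOn (LCFunction.rayIntegrand f z (-Real.pi)) (Set.Ioi ε) ∧
      IntervalIntegrable (LCFunction.circleIntegrand f z ε) MeasureTheory.volume
        (-Real.pi) Real.pi ∧
      MeasureTheory.IntegrableOn (LCFunction.rayIntegrand f z Real.pi) (Set.Ioi ε)) ∧
    -- it is an entire function of `z`
    Differentiable ℂ (LCFunction.hankelI f ε) ∧
    -- for `Re z > 1` the series defining `L(z, f)` converge
    (∀ z : ℂ, 1 < z.re →
      (∀ n : ℕ, LCFunction.nIdx f ≤ n → Summable (LCFunction.genPowTerm f (n : ℂ) (-z))) ∧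
      Summable (fun n : ℕ => LCFunction.genPow f ((n + LCFunction.nIdx f : ℕ) : ℂ) (-z))) ∧
    -- and, off the integers `2, 3, …`, the representation of `L(z, f)` holds
    (∀ z : ℂ, 1 < z.re → (∀ m : ℕ, 2 ≤ m → z ≠ (m : ℂ)) →
      LCFunction.LC f z = Complex.Gamma (1 - z) * LCFunction.hankelI f ε z) := by
  obtain ⟨C, R, hC, hR, hRn, h⟩ := LCFunction.exists_norm_pNum_le hρ
  have hp := LCFunction.differentiable_pFun hC.le hR.le h
  have hpi : (Real.pi : ℂ) ≠ 0 := Complex.ofReal_ne_zero.2 Real.pi_ne_zero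
  refine ⟨fun z => ⟨?_, ?_, ?_⟩, LCFunction.differentiable_hankelI hp hC.le hRn h hε hε',
    fun z hz => ⟨fun n hn => ?_, LCFunction.summable_genPow hC.le hR.le hRn h hz⟩,
    fun z hz hz' => ?_⟩
  · rw [funext (LCFunction.rayIntegrand_neg_pi f z)]
    exact (LCFunction.integrableOn_cpow_mul_hankelKernel_neg hp hC.le hRn h hε z).const_mul _
  · rw [funext (LCFunction.circleIntegrand_eq f z hε)]
    have := LCFunction.continuous_regularPart_circle hp hε hε'
    exact Continuous.intervalIntegrable (by fun_prop) _ _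
  · rw [funext (LCFunction.rayIntegrand_pi f z)]
    exact (LCFunction.integrableOn_cpow_mul_hankelKernel_neg hp hC.le hRn h hε z).const_mul _
  · exact LCFunction.summable_genPowTerm hR.le (hRn.trans_le (Nat.cast_le.2 hn)) h
      (zero_lt_one.trans hz)
  -- The zeros of `sin(πz)` are the integers, and those with real part above `1` are the excluded
  -- ones.
  · have hsin : Complex.sin (Real.pi * z) ≠ 0 := fun h0 => by
      obtain ⟨k, hk⟩ := Complex.sin_eq_zero_iff.1 h0
      have hzk : z = k := mul_left_cancel₀ hpi (by rw [hk, mul_comm])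
      rw [hzk, Complex.intCast_re] at hz
      have hk1 : 1 < k := by exact_mod_cast hz
      refine hz' k.toNat (by omega) ?_
      rw [hzk, ← Int.cast_natCast, Int.toNat_of_nonneg (by omega)]
    have hG := Complex.Gamma_mul_Gamma_one_sub z
    rw [eq_div_iff hsin] at hG
    rw [LCFunction.hankelI_eq_mellin hp hC.le hRn h hε hε' hz,
      ← LCFunction.Gamma_mul_LC hC.le hR.le hRn h hz]
    calc _ = Complex.Gamma z * Complex.Gamma (1 - z) * Complex.sin (Real.pi * z) / Real.pi *
          LCFunction.LC f z := by rw [hG, div_self hpi, one_mul]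
      _ = _ := by ring
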